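/- Let $A$ be a simple unital $C^*$-algebra (with $1\neq 0$), and let $\alpha\colon\mathbb{T}\to\mathrm{Aut}(A)$ be a continuous action of the circle group, i.e. a group homomorphism such that $\zeta\mapsto\alpha_\zeta(a)$ is norm continuous for every $a\in A$. Assume that $\alpha$ has the Rokhlin property: for every $\varepsilon>0$ and every finite subset $F\subseteq A$ there is a unitary $u\in A$ such that $\|\alpha_\zeta(u)-\zeta u\|<\varepsilon$ for all $\zeta\in\mathbb{T}$ and $\|ua-au\|<\varepsilon$ for all $a\in F$. Then the fixed point algebra $A^\alpha=\{a\in A:\alpha_\zeta(a)=a\text{ for all }\zeta\in\mathbb{T}\}$ and the (full) crossed product $A\rtimes_\alpha\mathbb{T}$ are simple $C^*$-algebras. Here a $C^*$-algebra is simple if it is nonzero and its only closed two-sided ideals are $\{0\}$ and itself. The crossed product $A\rtimes_\alpha\mathbb{T}$ is the completion of the convolution algebra $C(\mathbb{T},A)$ in the universal norm $\|f\|=\sup_{(\pi,v)}\bigl\|\int_{\mathbb{T}}\pi(f(\zeta))v_\zeta\,d\zeta\bigr\|$, the supremum being over all covariant representations $(\pi,v)$ of $(A,\mathbb{T},\alpha)$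 on Hilbert spaces, with $\pi$ unital and $v$ strongly continuous. -/

import Mathlib

open scoped ENNReal

noncomputable section

universe u

/-- A C*-algebra is simple if it is nonzero and has no closed two-sided ideals besides zero and
itself. -/
def IsSimpleCStarAlgebra (B : Type*) [NonUnitalCStarAlgebra B] : Prop :=
  Nontrivial B ∧ ∀ I : TwoSidedIdeal B, IsClosed (I : Set B) → I = ⊥ ∨ I = ⊤

namespace CircleAction

variable {A : Type u} [CStarAlgebra A]

/-- Continuity of a circle action, for the topology of pointwise norm convergence on `Aut(A)`. -/
def IsContinuous (α : Circle →* (A ≃⋆ₐ[ℂ] A)) : Prop :=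
  ∀ a : A, Continuous fun ζ : Circle => α ζ a

/-- The Rokhlin property for a circle action on a unital C*-algebra. -/
def RokhlinProperty (α : Circle →* (A ≃⋆ₐ[ℂ] A)) : Prop :=
  ∀ ε : ℝ, 0 < ε → ∀ F : Finset A, ∃ u ∈ unitary A,
    (∀ ζ : Circle, ‖α ζ u - (ζ : ℂ) • u‖ < ε) ∧ ∀ a ∈ F, ‖u * a - a * u‖ < ε

/-- The fixed point algebra `A^α`. -/
def fixedPointAlgebra (α : Circle →* (A ≃⋆ₐ[ℂ] A)) : StarSubalgebra ℂ A where
  carrier := {a | ∀ ζ : Circle, α ζ a = a}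
  mul_mem' ha hb ζ := by rw [map_mul, ha ζ, hb ζ]
  add_mem' ha hb ζ := by rw [map_add, ha ζ, hb ζ]
  algebraMap_mem' r ζ := by rw [Algebra.algebraMap_eq_smul_one, map_smul, map_one]
  star_mem' ha ζ := by rw [map_star, ha ζ]

theorem isClosed_fixedPointAlgebra (α : Circle →* (A ≃⋆ₐ[ℂ] A)) :
    IsClosed (fixedPointAlgebra α : Set A) := by
  have h : (fixedPointAlgebra α : Set A) = ⋂ ζ : Circle, {a | α ζ a = a} := by
    ext a
    simp only [Set.mem_iInter]
    exact Iff.rfl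
  rw [h]
  exact isClosed_iInter fun ζ =>
    isClosed_eq (StarAlgEquiv.isometry (α ζ)).continuous continuous_id

instance instCStarAlgebraFixedPointAlgebra (α : Circle →* (A ≃⋆ₐ[ℂ] A)) :
    CStarAlgebra (fixedPointAlgebra α) :=
  StarSubalgebra.cstarAlgebra (fixedPointAlgebra α) (h_closed := isClosed_fixedPointAlgebra α)

/-- A (nondegenerate) covariant representation of `(A, 𝕋, α)` on a Hilbert space: a unital
`*`-representation `π` of `A` and a strongly continuous unitary representation `v` of the circle
with `v_ζ π(a) v_ζ* = π(α_ζ(a))`. -/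
structure CovariantRep (α : Circle →* (A ≃⋆ₐ[ℂ] A)) where
  H : Type u
  [normedAddCommGroup : NormedAddCommGroup H]
  [innerProductSpace : InnerProductSpace ℂ H]
  [completeSpace : CompleteSpace H]
  π : A →⋆ₐ[ℂ] (H →L[ℂ] H)
  v : Circle →* unitary (H →L[ℂ] H)
  continuous_v : ∀ ξ : H, Continuous fun ζ : Circle => (v ζ : H →L[ℂ] H) ξ
  covariant : ∀ (ζ : Circle) (a : A),
    (v ζ : H →L[ℂ] H) * π a * star (v ζ : H →L[ℂ] H) = π (α ζ a)

attribute [instance] CovariantRep.normedAddCommGroup CovariantRep.innerProductSpace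
  CovariantRep.completeSpace

namespace CovariantRep

variable {α : Circle →* (A ≃⋆ₐ[ℂ] A)} (ρ : CovariantRep α)

theorem norm_π_le (a : A) : ‖ρ.π a‖ ≤ ‖a‖ := NonUnitalStarAlgHom.norm_apply_le ρ.π a

theorem continuous_integrand (f : C(Circle, A)) (ξ : ρ.H) :
    Continuous fun t : AddCircle (1 : ℝ) =>
      ρ.π (f t.toCircle) ((ρ.v t.toCircle : ρ.H →L[ℂ] ρ.H) ξ) := by
  have hπ : Continuous ρ.π :=
    AddMonoidHomClass.continuous_of_bound ρ.π 1 fun a => by simpa using ρ.norm_π_le a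
  exact (hπ.comp (f.continuous.comp AddCircle.continuous_toCircle)).clm_apply
    ((ρ.continuous_v ξ).comp AddCircle.continuous_toCircle)

theorem norm_integrand_le (f : C(Circle, A)) (ξ : ρ.H) (ζ : Circle) :
    ‖ρ.π (f ζ) ((ρ.v ζ : ρ.H →L[ℂ] ρ.H) ξ)‖ ≤ ‖f‖ * ‖ξ‖ := by
  calc _ ≤ ‖ρ.π (f ζ)‖ * ‖(ρ.v ζ : ρ.H →L[ℂ] ρ.H) ξ‖ := ContinuousLinearMap.le_opNorm _ _
    _ ≤ ‖f‖ * ‖ξ‖ := by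
      gcongr
      · exact (ρ.norm_π_le _).trans (f.norm_coe_le_norm ζ)
      · exact (ContinuousLinearMap.norm_map_of_mem_unitary (ρ.v ζ).2 ξ).le

theorem integrable_integrand (f : C(Circle, A)) (ξ : ρ.H) :
    MeasureTheory.Integrable (fun t : AddCircle (1 : ℝ) =>
      ρ.π (f t.toCircle) ((ρ.v t.toCircle : ρ.H →L[ℂ] ρ.H) ξ)) AddCircle.haarAddCircle :=
  (ρ.continuous_integrand f ξ).integrable_of_hasCompactSupport
    (HasCompactSupport.of_compactSpace _)

/-- The integrated form `(π ⋊ v)(f) ξ = ∫_𝕋 π(f(ζ)) v_ζ ξ dζ` of a covariant representation, for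
the normalized Haar measure; here the circle is parametrized by `ℝ/ℤ`. -/
def integrated (f : C(Circle, A)) : ρ.H →L[ℂ] ρ.H :=
  LinearMap.mkContinuous
    { toFun := fun ξ => ∫ t : AddCircle (1 : ℝ),
        ρ.π (f t.toCircle) ((ρ.v t.toCircle : ρ.H →L[ℂ] ρ.H) ξ) ∂AddCircle.haarAddCircle
      map_add' := fun ξ η => by
        simp only [map_add]
        exact MeasureTheory.integral_add (ρ.integrable_integrand f ξ) (ρ.integrable_integrand f η)
      map_smul' := fun c ξ => by
        simp only [map_smul, RingHom.id_apply]
        exact MeasureTheory.integral_smul c _ }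
    ‖f‖ fun ξ => by
      simpa using MeasureTheory.norm_integral_le_of_norm_le_const
        (μ := AddCircle.haarAddCircle (T := (1 : ℝ)))
        (Filter.Eventually.of_forall fun t => ρ.norm_integrand_le f ξ t.toCircle)

theorem norm_integrated_le (f : C(Circle, A)) : ‖ρ.integrated f‖ ≤ ‖f‖ :=
  LinearMap.mkContinuous_norm_le _ (norm_nonneg f) _

end CovariantRep

/-- The universal integrated form: the direct sum of the integrated forms of all covariant
representations (on Hilbert spaces in the universe of `A`, which suffices for all cyclic ones).
Its norm is the universal norm `f ↦ sup ‖(π ⋊ v)(f)‖` on `C(𝕋, A)`. -/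
def universalIntegrated (α : Circle →* (A ≃⋆ₐ[ℂ] A)) (f : C(Circle, A)) :
    lp (fun ρ : CovariantRep α => ρ.H →L[ℂ] ρ.H) ∞ :=
  ⟨fun ρ => ρ.integrated f,
    memℓp_infty ⟨‖f‖, by rintro _ ⟨ρ, rfl⟩; exact ρ.norm_integrated_le f⟩⟩

/-- The (full) crossed product `A ⋊_α 𝕋`: the completion of the convolution `*`-algebra `C(𝕋, A)`
in the universal norm, realized as the C*-algebra generated by its image under the universal
integrated form. -/
def crossedProduct (α : Circle →* (A ≃⋆ₐ[ℂ] A)) :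
    NonUnitalStarSubalgebra ℂ (lp (fun ρ : CovariantRep α => ρ.H →L[ℂ] ρ.H) ∞) :=
  (NonUnitalStarAlgebra.adjoin ℂ (Set.range (universalIntegrated α))).topologicalClosure

instance instNonUnitalCStarAlgebraCrossedProduct (α : Circle →* (A ≃⋆ₐ[ℂ] A)) :
    NonUnitalCStarAlgebra (crossedProduct α) :=
  NonUnitalStarSubalgebra.nonUnitalCStarAlgebra (crossedProduct α)
    (h_closed := NonUnitalStarSubalgebra.isClosed_topologicalClosure _)

end CircleAction

end

/-! Write `A_n` for the elements of degree `n`, those with `α_ζ(a) = ζⁿa`, and `E` for the average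
over the circle, which projects onto `A_0 = A^α`. Averaging a Rokhlin unitary `u` against `ζ⁻¹`
gives an element of `A_1` close to `u`, hence invertible and almost commuting with a given `b`.
Products of such elements and their inverses give, in every degree, invertibles `w` with `w⁻¹bw`
close to `b`.

Fixed points: let `I` be a closed ideal of `A^α` and `b ∈ I`. If `x` and `w` have degree `-n` and
`y` has degree `n`, then `xby` is close to `(xw⁻¹)b(wy) ∈ I`. By density `E(xby) ∈ I` for all `x, y
∈ A`, so `{a | E(xay) ∈ I for all x, y}` is a closed ideal of `A` containing `I`. It is `0` or `A`,
and in the second case `1 = E(1) ∈ I`.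

Crossed product: it is densely spanned by the `a p_n`, where `p_n` is the `n`-th spectral projection
of the implementing representation and `p_n a = a p_(n-m)` for `a ∈ A_m`. The corner at `p_0` is a
copy of the simple algebra `A^α`, and `p_0` is full because `p_n = w p_0 w⁻¹` for invertible `w ∈
A_n`. Finally `p_0 ≠ 0`, as the GNS representation of an invariant state shows. -/

noncomputable section

universe u

open MeasureTheory AddCircle

/-! ### Fourier analysis of circle representations on Banach spaces. -/

/-- A strongly continuous isometric representation of the circle on a Banach space. -/
structure CircleRep {E : Type*} [NormedAddCommGroup E] [NormedSpace ℂ E]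
    (β : Circle →* (E →L[ℂ] E)) : Prop where
  norm_le : ∀ s x, ‖β s x‖ ≤ ‖x‖
  continuous : ∀ x, Continuous fun s => β s x

namespace CircleRep

section

variable {E : Type*} [NormedAddCommGroup E] [NormedSpace ℂ E]

/-- The spectral subspace of degree `n`. -/
def spectral (β : Circle →* (E →L[ℂ] E)) (n : ℤ) : Submodule ℂ E where
  carrier := {x | ∀ s : Circle, β s x = ((s : ℂ) ^ n) • x}
  add_mem' hx hy s := by rw [map_add, hx s, hy s, smul_add]
  zero_mem' s := by simp
  smul_mem' c x hx s := by rw [map_smul, hx s, smul_comm]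

theorem fourier_eq (n : ℤ) (t : AddCircle (1 : ℝ)) : fourier n t = (t.toCircle : ℂ) ^ n := by
  rw [fourier_apply, toCircle_zsmul, Circle.coe_zpow]

theorem exists_toCircle (s : Circle) : ∃ t : AddCircle (1 : ℝ), t.toCircle = s := by
  obtain ⟨t, ht⟩ := (homeomorphCircle (T := (1 : ℝ)) one_ne_zero).surjective s
  exact ⟨t, by rw [← ht, homeomorphCircle_apply]⟩

theorem norm_circle_zpow (s : Circle) (n : ℤ) : ‖(s : ℂ) ^ n‖ = 1 := by
  rw [norm_zpow, Circle.norm_coe, one_zpow]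

variable {β : Circle →* (E →L[ℂ] E)} (hβ : CircleRep β)
include hβ

theorem continuous_toCircle (x : E) : Continuous fun t : AddCircle (1 : ℝ) => β t.toCircle x :=
  (hβ.continuous x).comp AddCircle.continuous_toCircle

theorem continuous_integrand (n : ℤ) (x : E) :
    Continuous fun t : AddCircle (1 : ℝ) => fourier n t • β t.toCircle x :=
  (map_continuous (fourier n)).smul (hβ.continuous_toCircle x)

theorem integrable_integrand (n : ℤ) (x : E) :
    Integrable (fun t : AddCircle (1 : ℝ) => fourier n t • β t.toCircle x) haarAddCircle :=
  (hβ.continuous_integrand n x).integrable_of_hasCompactSupport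
    (HasCompactSupport.of_compactSpace _)

theorem norm_integrand_le (n : ℤ) (x : E) (t : AddCircle (1 : ℝ)) :
    ‖fourier n t • β t.toCircle x‖ ≤ ‖x‖ := by
  rw [norm_smul, fourier_eq, norm_circle_zpow, one_mul]
  exact hβ.norm_le _ _

/-- The projection onto the spectral subspace of degree `n`. -/
def coef (n : ℤ) : E →L[ℂ] E :=
  LinearMap.mkContinuous
    { toFun := fun x => fourierCoeff (fun t : AddCircle (1 : ℝ) => β t.toCircle x) n
      map_add' := fun x y => by
        simp only [fourierCoeff, map_add, smul_add]
        exact integral_add (hβ.integrable_integrand _ x) (hβ.integrable_integrand _ y)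
      map_smul' := fun c x => by
        simp only [fourierCoeff, map_smul, RingHom.id_apply]
        rw [← integral_smul]
        simp only [smul_comm c] }
    1 fun x => by
      simpa [fourierCoeff] using norm_integral_le_of_norm_le_const
        (μ := haarAddCircle (T := (1 : ℝ)))
        (Filter.Eventually.of_forall fun t => hβ.norm_integrand_le (-n) x t)

theorem coef_apply (n : ℤ) (x : E) :
    hβ.coef n x = ∫ t : AddCircle (1 : ℝ), fourier (-n) t • β t.toCircle x ∂haarAddCircle := rfl

theorem norm_coef_le (n : ℤ) (x : E) : ‖hβ.coef n x‖ ≤ ‖x‖ := by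
  simpa using (hβ.coef n).le_of_opNorm_le (LinearMap.mkContinuous_norm_le _ zero_le_one _) x

end

section

variable {E : Type*} [NormedAddCommGroup E] [NormedSpace ℂ E] [CompleteSpace E]
  {β : Circle →* (E →L[ℂ] E)} (hβ : CircleRep β)
include hβ

/-- Translation invariance of Haar measure: shifting the right-hand integral by `r` produces a
factor that cancels `sⁿ`. -/
theorem coef_mem_spectral (n : ℤ) (x : E) : hβ.coef n x ∈ spectral β n := by
  intro s
  obtain ⟨r, rfl⟩ := exists_toCircle s
  rw [coef_apply, ← ContinuousLinearMap.integral_comp_comm _ (hβ.integrable_integrand _ _),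
    ← integral_smul, ← integral_add_left_eq_self _ r]
  conv_rhs => rw [← integral_add_left_eq_self _ r]
  rw [integral_add_left_eq_self (fun t : AddCircle (1 : ℝ) =>
    (β r.toCircle) (fourier (-n) t • β t.toCircle x)) r]
  congr 1
  ext t
  rw [map_smul, smul_smul, toCircle_add, map_mul, fourier_eq, fourier_eq, toCircle_add,
    Circle.coe_mul, mul_zpow, ← mul_assoc, ← zpow_add₀ (Circle.coe_ne_zero _), add_neg_cancel,
    zpow_zero, one_mul]
  rfl

theorem coef_of_mem_spectral {k : ℤ} {x : E} (hx : x ∈ spectral β k) (n : ℤ) :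
    hβ.coef n x = if k = n then x else 0 := by
  have h : hβ.coef n x = fourierCoeff (fourier (T := 1) k) n • x := by
    rw [coef_apply, fourierCoeff, ← integral_smul_const]
    congr 1
    ext t
    rw [hx, smul_smul, ← fourier_eq, smul_eq_mul]
  rw [h, fourierCoeff_fourier]
  by_cases hk : k = n
  · subst hk; simp
  · rw [Pi.single_eq_of_ne (fun h => hk h.symm), zero_smul, if_neg hk]

/-- This turns an approximately homogeneous element, such as a Rokhlin unitary, into a nearby
exactly homogeneous one. -/
theorem norm_coef_sub_le {n : ℤ} {x : E} {ε : ℝ}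
    (hx : ∀ s : Circle, ‖β s x - ((s : ℂ) ^ n) • x‖ ≤ ε) : ‖hβ.coef n x - x‖ ≤ ε := by
  have h : hβ.coef n x - x = ∫ t : AddCircle (1 : ℝ), (fourier (-n) t • β t.toCircle x - x)
      ∂haarAddCircle := by
    rw [integral_sub (hβ.integrable_integrand _ _) (integrable_const _), coef_apply]
    simp
  rw [h]
  refine (norm_integral_le_of_norm_le_const (C := ε) (Filter.Eventually.of_forall fun t => ?_)).trans
    (by simp)
  have h2 : fourier (-n) t • β t.toCircle x - x =
      ((t.toCircle : ℂ) ^ (-n)) • (β t.toCircle x - ((t.toCircle : ℂ) ^ n) • x) := by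
    rw [smul_sub, smul_smul, ← zpow_add₀ (Circle.coe_ne_zero _), neg_add_cancel, zpow_zero,
      one_smul, fourier_eq]
  rw [h2, norm_smul, norm_circle_zpow, one_mul]
  exact hx _

/-- The elements of the spectral subspaces span a dense subspace. -/
theorem dense_span_spectral : Dense (Submodule.span ℂ (⋃ n, (spectral β n : Set E)) : Set E) := by
  refine Submodule.dense_iff_topologicalClosure_eq_top.mpr ?_
  by_contra hne
  obtain ⟨x, hx⟩ : ∃ x, x ∉ (Submodule.span ℂ (⋃ n, (spectral β n : Set E))).topologicalClosure := by
    by_contra! h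
    exact hne (eq_top_iff.mpr fun x _ => h x)
  set p := (Submodule.span ℂ (⋃ n, (spectral β n : Set E))).topologicalClosure
  obtain ⟨f, hfx, hf⟩ : ∃ f : E →L[ℂ] ℂ, f x ≠ 0 ∧ ∀ y ∈ p, f y = 0 := by
    have hp : IsClosed (p : Set E) := Submodule.isClosed_topologicalClosure _
    have hx' : p.mkQ x ≠ 0 := fun h => hx ((Submodule.Quotient.mk_eq_zero p).mp h)
    obtain ⟨g, hg⟩ := SeparatingDual.exists_ne_zero (R := ℂ) (V := E ⧸ p) hx'
    exact ⟨g.comp p.mkQL, hg, fun y hy => by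
      have : p.mkQ y = 0 := (Submodule.Quotient.mk_eq_zero p).mpr hy
      change g (p.mkQ y) = 0
      rw [this, map_zero]⟩
  -- All Fourier coefficients of this orbit function vanish, so its Fourier series converges to it
  -- and `g 0 = f x` is zero.
  let g : C(AddCircle (1 : ℝ), ℂ) := ⟨fun t => f (β t.toCircle x),
    f.continuous.comp (hβ.continuous_toCircle x)⟩
  have hg : fourierCoeff g = 0 := by
    ext n
    have : fourierCoeff g n = f (hβ.coef n x) := by
      rw [coef_apply, ← ContinuousLinearMap.integral_comp_comm _ (hβ.integrable_integrand _ _)]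
      simp [fourierCoeff, g]
    rw [this]
    exact hf _ (Submodule.le_topologicalClosure _ (Submodule.subset_span
      (Set.mem_iUnion.mpr ⟨n, hβ.coef_mem_spectral n x⟩)))
  have h0 := has_pointwise_sum_fourier_series_of_summable (f := g)
    (by rw [hg]; exact summable_zero) 0
  rw [hg] at h0
  have h1 : g 0 = 0 := by
    exact h0.unique (by simp)
  refine hfx ?_
  simpa [g] using h1

end

end CircleRep

/-- The form in which density is used: with `K` a kernel or a preimage, identities and memberships
need checking only on homogeneous elements. -/
theorem CircleRep.mem_of_forall_spectral {E : Type*} [NormedAddCommGroup E] [NormedSpace ℂ E]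
    [CompleteSpace E] {β : Circle →* (E →L[ℂ] E)} (hβ : CircleRep β) (K : Submodule ℂ E)
    (hK : IsClosed (K : Set E)) (h : ∀ n, ∀ x ∈ CircleRep.spectral β n, x ∈ K) (x : E) : x ∈ K := by
  have h1 : Submodule.span ℂ (⋃ n, (CircleRep.spectral β n : Set E)) ≤ K :=
    Submodule.span_le.mpr (Set.iUnion_subset fun n => h n)
  exact hK.closure_subset_iff.mpr h1 (hβ.dense_span_spectral x)

/-! ### The grading of `A` and homogeneous invertibles from the Rokhlin property. -/

namespace CircleAction

open CircleRep

variable {A : Type u} [CStarAlgebra A]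

/-- A circle action, as a representation by continuous linear maps. -/
def toRep (α : Circle →* (A ≃⋆ₐ[ℂ] A)) : Circle →* (A →L[ℂ] A) where
  toFun ζ := LinearMap.mkContinuous ((α ζ : A ≃⋆ₐ[ℂ] A).toAlgEquiv.toLinearMap) 1
    fun x => by
      rw [one_mul]
      exact (StarAlgEquiv.norm_map (α ζ) x).le
  map_one' := by ext; simp
  map_mul' s t := by ext; simp

variable {α : Circle →* (A ≃⋆ₐ[ℂ] A)}

@[simp]
theorem toRep_apply (ζ : Circle) (a : A) : toRep α ζ a = α ζ a := rfl

theorem IsContinuous.circleRep (hα : IsContinuous α) : CircleRep (toRep α) where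
  norm_le s x := (StarAlgEquiv.norm_map (α s) x).le
  continuous := hα

theorem mem_spectral_toRep {n : ℤ} {x : A} :
    x ∈ spectral (toRep α) n ↔ ∀ s : Circle, α s x = ((s : ℂ) ^ n) • x := Iff.rfl

theorem mul_mem_spectral {m n : ℤ} {x y : A} (hx : x ∈ spectral (toRep α) m)
    (hy : y ∈ spectral (toRep α) n) : x * y ∈ spectral (toRep α) (m + n) := by
  intro s
  rw [toRep_apply, map_mul, mem_spectral_toRep.mp hx s, mem_spectral_toRep.mp hy s, smul_mul_smul_comm,
    zpow_add₀ (Circle.coe_ne_zero _)]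

theorem star_mem_spectral {n : ℤ} {x : A} (hx : x ∈ spectral (toRep α) n) :
    star x ∈ spectral (toRep α) (-n) := by
  intro s
  rw [toRep_apply, map_star, mem_spectral_toRep.mp hx s, star_smul, star_zpow₀, zpow_neg, ← inv_zpow,
    ← Circle.coe_inv, Circle.coe_inv_eq_conj]
  rfl

theorem one_mem_spectral : (1 : A) ∈ spectral (toRep α) 0 := fun s => by simp

theorem inv_mem_spectral {n : ℤ} {w : Aˣ} (hw : (w : A) ∈ spectral (toRep α) n) :
    ((w⁻¹ : Aˣ) : A) ∈ spectral (toRep α) (-n) := by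
  intro s
  have h : α s (w⁻¹ : Aˣ) * α s w = 1 := by rw [← map_mul, Units.inv_mul, map_one]
  rw [mem_spectral_toRep.mp hw s, mul_smul_comm, ← smul_mul_assoc] at h
  have h2 := Units.mul_eq_one_iff_eq_inv.mp h
  conv_rhs => rw [← h2, smul_smul, ← zpow_add₀ (Circle.coe_ne_zero _), neg_add_cancel, zpow_zero,
    one_smul]
  rfl

theorem mem_fixedPointAlgebra_iff {a : A} :
    a ∈ fixedPointAlgebra α ↔ a ∈ spectral (toRep α) 0 := by
  rw [mem_spectral_toRep]
  simp only [zpow_zero, one_smul]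
  rfl

theorem RokhlinProperty.exists_unit_spectral_one (hR : RokhlinProperty α) (hα : IsContinuous α)
    (b : A) {ε : ℝ} (hε : 0 < ε) :
    ∃ w : Aˣ, (w : A) ∈ spectral (toRep α) 1 ∧ ‖(w : A)‖ ≤ 2 ∧ ‖((w⁻¹ : Aˣ) : A)‖ ≤ 2 ∧
      ‖(w : A) * b - b * w‖ < ε := by
  cases subsingleton_or_nontrivial A with
  | inl h =>
    refine ⟨1, ?_, ?_, ?_, ?_⟩
    · rw [Subsingleton.elim ((1 : Aˣ) : A) 0]; exact zero_mem _
    all_goals simp [Subsingleton.elim _ (0 : A), hε]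
  | inr h =>
  -- The bound `1/2` gives invertibility and the norm bounds by 2; the other bound makes replacing
  -- `u` by `w` cost at most `2δ‖b‖ ≤ ε/2` in the commutator.
  set δ := min (1 / 2) (ε / (4 * (‖b‖ + 1))) with hδ
  have hb := norm_nonneg b
  have hδ0 : 0 < δ := by positivity
  obtain ⟨u, hu, h1, h2⟩ := hR (min δ (ε / 4)) (by positivity) {b}
  set w := hα.circleRep.coef 1 u with hw
  have hwu : ‖w - u‖ ≤ δ := hα.circleRep.norm_coef_sub_le fun s => by
    simpa using (h1 s).le.trans (min_le_left _ _)
  have hun : ‖u‖ = 1 := CStarRing.norm_of_mem_unitary hu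
  have hwn : ‖w‖ ≤ 1 := (hα.circleRep.norm_coef_le 1 u).trans hun.le
  have hsun : ‖star u‖ = 1 := by rw [norm_star, hun]
  let U : Aˣ := Unitary.toUnits ⟨u, hu⟩
  have hUi : ((U⁻¹ : Aˣ) : A) = star u := rfl
  let W : Aˣ := U.ofNearby w (by
    rw [hUi, hsun, inv_one]
    have : δ ≤ 1 / 2 := min_le_left _ _
    calc ‖w - U‖ ≤ δ := hwu
      _ < 1 := by linarith)
  have hW : (W : A) = w := rfl
  have hδ2 : δ ≤ 1 / 2 := min_le_left _ _
  refine ⟨W, by rw [hW]; exact hα.circleRep.coef_mem_spectral _ _, by rw [hW]; linarith, ?_, ?_⟩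
  -- This identity bounds `‖w⁻¹‖` by `1 + ‖w⁻¹‖/2`.
  · have h3 : ((W⁻¹ : Aˣ) : A) = star u + ((W⁻¹ : Aˣ) : A) * (u - w) * star u := by
      rw [mul_sub, sub_mul, mul_assoc _ u, Unitary.mul_star_self_of_mem hu, mul_one, ← hW,
        Units.inv_mul, one_mul]
      abel
    have h4 : ‖((W⁻¹ : Aˣ) : A)‖ ≤ 1 + ‖((W⁻¹ : Aˣ) : A)‖ * (1 / 2) := by
      calc ‖((W⁻¹ : Aˣ) : A)‖ = ‖star u + ((W⁻¹ : Aˣ) : A) * (u - w) * star u‖ := by rw [← h3]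
        _ ≤ ‖star u‖ + ‖((W⁻¹ : Aˣ) : A)‖ * ‖u - w‖ * ‖star u‖ :=
          (norm_add_le _ _).trans (by gcongr; exact norm_mul₃_le)
        _ ≤ _ := by
          rw [hsun, mul_one, norm_sub_rev]
          gcongr
          exact hwu.trans hδ2
    linarith
  · have h3 : (W : A) * b - b * W = (w - u) * b - b * (w - u) + (u * b - b * u) := by
      rw [hW]; noncomm_ring
    have h4 : ‖u * b - b * u‖ < ε / 4 := (h2 b (by simp)).trans_le (min_le_right _ _)
    have h5 : δ * ‖b‖ ≤ ε / 4 := by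
      have : δ ≤ ε / (4 * (‖b‖ + 1)) := min_le_right _ _
      calc δ * ‖b‖ ≤ ε / (4 * (‖b‖ + 1)) * (‖b‖ + 1) := by gcongr; linarith
        _ = ε / 4 := by field_simp
    calc ‖(W : A) * b - b * W‖ ≤ ‖w - u‖ * ‖b‖ + ‖b‖ * ‖w - u‖ + ‖u * b - b * u‖ := by
          rw [h3]
          refine (norm_add_le _ _).trans (by
            gcongr
            exact (norm_sub_le _ _).trans (by gcongr <;> exact norm_mul_le _ _))
      _ ≤ δ * ‖b‖ + ‖b‖ * δ + ‖u * b - b * u‖ := by gcongr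
      _ < ε := by nlinarith

/-- The induction step for the degree: `c` will be an earlier conjugate `v⁻¹bv`, already close to
`b`. -/
theorem norm_conj_sub_le (w : Aˣ) (b c : A) (h : ‖(w : A)‖ ≤ 2) (h' : ‖((w⁻¹ : Aˣ) : A)‖ ≤ 2) :
    ‖((w⁻¹ : Aˣ) : A) * c * w - b‖ ≤ 4 * ‖c - b‖ + 2 * ‖(w : A) * b - b * w‖ := by
  have e : ((w⁻¹ : Aˣ) : A) * c * w - b =
      ((w⁻¹ : Aˣ) : A) * (c - b) * w - ((w⁻¹ : Aˣ) : A) * (w * b - b * w) := by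
    rw [mul_sub (_ : A) (w * b), ← mul_assoc, Units.inv_mul]
    noncomm_ring
  calc _ ≤ ‖((w⁻¹ : Aˣ) : A)‖ * ‖c - b‖ * ‖(w : A)‖ + ‖((w⁻¹ : Aˣ) : A)‖ * ‖(w : A) * b - b * w‖ := by
        rw [e]
        exact (norm_sub_le _ _).trans (add_le_add norm_mul₃_le (norm_mul_le _ _))
    _ ≤ 2 * ‖c - b‖ * 2 + 2 * ‖(w : A) * b - b * w‖ := by gcongr
    _ = _ := by ring

/-- Every degree is realized by an invertible that almost commutes with a given element. -/
theorem RokhlinProperty.exists_unit_spectral (hR : RokhlinProperty α) (hα : IsContinuous α)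
    (b : A) (n : ℤ) : ∀ ε : ℝ, 0 < ε →
    ∃ w : Aˣ, (w : A) ∈ spectral (toRep α) n ∧ ‖((w⁻¹ : Aˣ) : A) * b * w - b‖ < ε := by
  induction n using Int.induction_on with
  | zero => exact fun ε hε => ⟨1, one_mem_spectral, by simpa⟩
  | succ n ih =>
    intro ε hε
    obtain ⟨v, hv, hvb⟩ := ih (ε / 8) (by positivity)
    obtain ⟨w, hw, hw1, hw2, hwb⟩ := hR.exists_unit_spectral_one hα b (ε := ε / 4) (by positivity)
    refine ⟨v * w, mul_mem_spectral hv hw, ?_⟩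
    have := norm_conj_sub_le w b (((v⁻¹ : Aˣ) : A) * b * v) hw1 hw2
    rw [mul_inv_rev, Units.val_mul, Units.val_mul]
    simp only [mul_assoc] at this hvb ⊢
    linarith
  | pred n ih =>
    intro ε hε
    obtain ⟨v, hv, hvb⟩ := ih (ε / 8) (by positivity)
    -- Passing from `w` to `w⁻¹` multiplies the commutator bound by 4, hence `ε / 16` instead of `ε
    -- / 4`.
    obtain ⟨w, hw, hw1, hw2, hwb⟩ := hR.exists_unit_spectral_one hα b (ε := ε / 16) (by positivity)
    refine ⟨v * w⁻¹, mul_mem_spectral hv (inv_mem_spectral hw), ?_⟩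
    have := norm_conj_sub_le w⁻¹ b (((v⁻¹ : Aˣ) : A) * b * v) hw2 (by simpa using hw1)
    have h2 : ‖((w⁻¹ : Aˣ) : A) * b - b * ((w⁻¹ : Aˣ) : A)‖ ≤ 4 * ‖(w : A) * b - b * w‖ := by
      have e : ((w⁻¹ : Aˣ) : A) * b - b * ((w⁻¹ : Aˣ) : A) =
          - (((w⁻¹ : Aˣ) : A) * (w * b - b * w) * ((w⁻¹ : Aˣ) : A)) := by
        rw [mul_sub, sub_mul, ← mul_assoc, Units.inv_mul, mul_assoc _ (b * (w : A)), mul_assoc b,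
          Units.mul_inv]
        noncomm_ring
      calc _ ≤ ‖((w⁻¹ : Aˣ) : A)‖ * ‖(w : A) * b - b * w‖ * ‖((w⁻¹ : Aˣ) : A)‖ := by
            rw [e, norm_neg]
            exact norm_mul₃_le
        _ ≤ 2 * ‖(w : A) * b - b * w‖ * 2 := by gcongr
        _ = _ := by ring
    rw [mul_inv_rev, Units.val_mul, Units.val_mul]
    simp only [mul_assoc] at this hvb ⊢
    linarith

/-! ### Simplicity of the fixed point algebra. -/

/-- Compression of a closed ideal of the fixed point algebra by the conditional expectation. -/
theorem coef_mem_of_mem (hR : RokhlinProperty α) (hα : IsContinuous α)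
    (K : Submodule ℂ A) (hK : IsClosed (K : Set A))
    (hl : ∀ x ∈ spectral (toRep α) 0, ∀ y ∈ K, x * y ∈ K)
    (hr : ∀ x ∈ spectral (toRep α) 0, ∀ y ∈ K, y * x ∈ K)
    (hK0 : K ≤ spectral (toRep α) 0) {b : A} (hb : b ∈ K) (x y : A) :
    hα.circleRep.coef 0 (x * b * y) ∈ K := by
  have key : ∀ m, ∀ x ∈ spectral (toRep α) m, ∀ n, ∀ y ∈ spectral (toRep α) n,
      hα.circleRep.coef 0 (x * b * y) ∈ K := by
    intro m x hx n y hy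
    have h := mul_mem_spectral (mul_mem_spectral hx (hK0 hb)) hy
    rw [hα.circleRep.coef_of_mem_spectral h]
    split_ifs with h0
    swap
    · exact zero_mem _
    have hm : m = -n := by omega
    subst hm
    refine hK.closure_subset (Metric.mem_closure_iff.mpr fun ε hε => ?_)
    -- With `w` of the degree of `x`, both `xw⁻¹` and `wy` have degree zero, so `(xw⁻¹)b(wy)` lies
    -- in `K`.
    obtain ⟨w, hw, hwb⟩ := hR.exists_unit_spectral hα b (-n)
      (ε / (‖x‖ * ‖y‖ + 1)) (by positivity)
    refine ⟨x * ((w⁻¹ : Aˣ) : A) * b * (w * y), hr _ ?_ _ (hl _ ?_ _ hb), ?_⟩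
    · simpa using mul_mem_spectral hw hy
    · simpa using mul_mem_spectral hx (inv_mem_spectral hw)
    · have e : x * b * y - x * ((w⁻¹ : Aˣ) : A) * b * (w * y) =
          x * (b - ((w⁻¹ : Aˣ) : A) * b * w) * y := by noncomm_ring
      rw [dist_eq_norm, e]
      have h3 : 0 ≤ ‖x‖ * ‖y‖ := by positivity
      calc _ ≤ ‖x‖ * ‖b - ((w⁻¹ : Aˣ) : A) * b * w‖ * ‖y‖ := norm_mul₃_le
        _ = ‖x‖ * ‖y‖ * ‖((w⁻¹ : Aˣ) : A) * b * w - b‖ := by rw [norm_sub_rev]; ring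
        _ ≤ ‖x‖ * ‖y‖ * (ε / (‖x‖ * ‖y‖ + 1)) := by gcongr
        _ < ε := by
          rw [mul_div_assoc', div_lt_iff₀ (by positivity)]
          nlinarith
  -- Homogeneity is removed by density, one variable at a time.
  let L (y : A) : A →L[ℂ] A :=
    (hα.circleRep.coef 0).comp ((ContinuousLinearMap.mul ℂ A).flip (b * y))
  have h1 : ∀ x, ∀ n, ∀ y ∈ spectral (toRep α) n, hα.circleRep.coef 0 (x * b * y) ∈ K := by
    intro x n y hy
    have := hα.circleRep.mem_of_forall_spectral (K.comap (L y).toLinearMap)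
      (hK.preimage (L y).continuous) (fun m x hx => by
        simpa [L, mul_assoc] using key m x hx n y hy) x
    simpa [L, mul_assoc] using this
  let R (x : A) : A →L[ℂ] A :=
    (hα.circleRep.coef 0).comp (ContinuousLinearMap.mul ℂ A (x * b))
  have := hα.circleRep.mem_of_forall_spectral (K.comap (R x).toLinearMap)
    (hK.preimage (R x).continuous) (fun n y hy => by
      simpa [R, mul_assoc] using h1 x n y hy) y
  simpa [R, mul_assoc] using this

/-- The subspace of `A` underlying a two-sided ideal of the fixed point algebra. -/
def idealSubmodule (I : TwoSidedIdeal (fixedPointAlgebra α)) : Submodule ℂ A where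
  carrier := Subtype.val '' (I : Set (fixedPointAlgebra α))
  add_mem' := by
    rintro _ _ ⟨a, ha, rfl⟩ ⟨b, hb, rfl⟩
    exact ⟨a + b, I.add_mem ha hb, rfl⟩
  zero_mem' := ⟨0, I.zero_mem, rfl⟩
  smul_mem' := by
    rintro c _ ⟨a, ha, rfl⟩
    refine ⟨c • a, ?_, rfl⟩
    rw [← one_mul a, ← smul_mul_assoc]
    exact I.mul_mem_left _ _ ha

theorem mem_idealSubmodule {I : TwoSidedIdeal (fixedPointAlgebra α)} {a : fixedPointAlgebra α} :
    (a : A) ∈ idealSubmodule I ↔ a ∈ I :=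
  ⟨fun ⟨_, hb, e⟩ => Subtype.ext e ▸ hb, fun h => ⟨a, h, rfl⟩⟩

theorem isClosed_idealSubmodule {I : TwoSidedIdeal (fixedPointAlgebra α)}
    (hI : IsClosed (I : Set (fixedPointAlgebra α))) : IsClosed (idealSubmodule I : Set A) :=
  (isClosed_fixedPointAlgebra α).isClosedEmbedding_subtypeVal.isClosedMap _ hI

theorem idealSubmodule_le (I : TwoSidedIdeal (fixedPointAlgebra α)) :
    idealSubmodule I ≤ spectral (toRep α) 0 := by
  rintro _ ⟨a, -, rfl⟩
  exact mem_fixedPointAlgebra_iff.mp a.2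

theorem isSimple_fixedPointAlgebra (hA : IsSimpleCStarAlgebra A) (hα : IsContinuous α)
    (hR : RokhlinProperty α) : IsSimpleCStarAlgebra (fixedPointAlgebra α) := by
  obtain ⟨hnt, hA⟩ := hA
  refine ⟨⟨0, 1, fun h => zero_ne_one (congrArg Subtype.val h)⟩, fun I hI => ?_⟩
  set K := idealSubmodule I
  have hK : IsClosed (K : Set A) := isClosed_idealSubmodule hI
  set E := hα.circleRep.coef 0
  have hKE : ∀ b ∈ K, ∀ x y, E (x * b * y) ∈ K := fun b hb =>
    coef_mem_of_mem hR hα K hK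
      (by
        rintro x hx _ ⟨y, hy, rfl⟩
        exact ⟨⟨x, mem_fixedPointAlgebra_iff.mpr hx⟩ * y, I.mul_mem_left _ _ hy, rfl⟩)
      (by
        rintro x hx _ ⟨y, hy, rfl⟩
        exact ⟨y * ⟨x, mem_fixedPointAlgebra_iff.mpr hx⟩, I.mul_mem_right _ _ hy, rfl⟩)
      (idealSubmodule_le I) hb
  -- The largest ideal of `A` that `E` maps into `K`.
  let J : TwoSidedIdeal A := TwoSidedIdeal.mk' {a | ∀ x y, E (x * a * y) ∈ K}
    (fun x y => by simp)
    (fun ha hb x y => by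
      rw [mul_add, add_mul, map_add]
      exact add_mem (ha x y) (hb x y))
    (fun ha x y => by
      rw [mul_neg, neg_mul, map_neg]
      exact neg_mem (ha x y))
    (fun {c a} ha x y => by
      rw [← mul_assoc]
      exact ha _ _)
    (fun {a c} ha x y => by
      rw [← mul_assoc, mul_assoc]
      exact ha _ _)
  have hJ (a : A) : a ∈ J ↔ ∀ x y, E (x * a * y) ∈ K := TwoSidedIdeal.mem_mk' ..
  have hJc : IsClosed (J : Set A) := by
    have : (J : Set A) = ⋂ x, ⋂ y, {a | E (x * a * y) ∈ K} := by
      ext a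
      simp only [Set.mem_iInter]
      exact hJ a
    rw [this]
    exact isClosed_iInter fun x => isClosed_iInter fun y => hK.preimage (by fun_prop)
  rcases hA J hJc with h | h
  · left
    refine le_bot_iff.mp fun a ha => ?_
    have : (a : A) ∈ J := (hJ _).mpr (hKE _ (mem_idealSubmodule.mpr ha))
    rw [h, TwoSidedIdeal.mem_bot] at this
    exact (TwoSidedIdeal.mem_bot _).mpr (Subtype.ext this)
  · right
    have h1 : (1 : A) ∈ J := h ▸ trivial
    have h2 := (hJ 1).mp h1 1 1
    rw [mul_one, mul_one, hα.circleRep.coef_of_mem_spectral one_mem_spectral, if_pos rfl] at h2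
    exact I.one_mem_iff.mp (mem_idealSubmodule (a := 1).mp h2)

end CircleAction

/-! ### Homogeneous generators of the crossed product. -/

theorem NonUnitalStarAlgebra.adjoin_le_of_mul_mem {B : Type*} [NonUnitalRing B] [StarRing B]
    [Module ℂ B] [IsScalarTower ℂ B B] [SMulCommClass ℂ B B] [StarModule ℂ B] (S : Set B)
    (hmul : ∀ x ∈ S, ∀ y ∈ S, x * y ∈ S) (hstar : star S ⊆ S) (K : Submodule ℂ B) (h : S ⊆ K) :
    (NonUnitalStarAlgebra.adjoin ℂ S : Set B) ⊆ K := by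
  intro x hx
  have h1 : Subsemigroup.closure (S ∪ star S) ≤ (⟨S, fun ha hb => hmul _ ha _ hb⟩ : Subsemigroup B) :=
    Subsemigroup.closure_le.mpr (Set.union_subset subset_rfl hstar)
  have h2 : x ∈ (NonUnitalStarAlgebra.adjoin ℂ S).toSubmodule := hx
  rw [NonUnitalStarAlgebra.adjoin_eq_span] at h2
  have h3 : Submodule.span ℂ (Subsemigroup.closure (S ∪ star S) : Set B) ≤ K :=
    Submodule.span_le.mpr fun y hy => h (h1 hy)
  exact h3 h2

/-- Exchanges the generators `R` for a multiplicative self-adjoint set `S` whose closed span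
contains `R`; then that closed span is already the whole algebra. -/
theorem NonUnitalStarAlgebra.topologicalClosure_adjoin_subset {B : Type*} [NonUnitalRing B]
    [StarRing B] [Module ℂ B] [IsScalarTower ℂ B B] [SMulCommClass ℂ B B] [StarModule ℂ B]
    [TopologicalSpace B] [IsSemitopologicalSemiring B] [ContinuousConstSMul ℂ B] [ContinuousStar B]
    (R S : Set B) (hmul : ∀ x ∈ S, ∀ y ∈ S, x * y ∈ S) (hstar : star S ⊆ S)
    (hR : ∀ K : Submodule ℂ B, IsClosed (K : Set B) → S ⊆ K → R ⊆ K)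
    (K : Submodule ℂ B) (hK : IsClosed (K : Set B)) (h : S ⊆ K) :
    ((NonUnitalStarAlgebra.adjoin ℂ R).topologicalClosure : Set B) ⊆ K := by
  have h1 : (NonUnitalStarAlgebra.adjoin ℂ R).topologicalClosure ≤
      (NonUnitalStarAlgebra.adjoin ℂ S).topologicalClosure :=
    NonUnitalStarSubalgebra.topologicalClosure_minimal _ (NonUnitalStarAlgebra.adjoin_le
      (hR (NonUnitalStarAlgebra.adjoin ℂ S).topologicalClosure.toSubmodule
        (NonUnitalStarSubalgebra.isClosed_topologicalClosure _)
        ((NonUnitalStarAlgebra.subset_adjoin ℂ S).trans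
          (NonUnitalStarSubalgebra.le_topologicalClosure _))))
      (NonUnitalStarSubalgebra.isClosed_topologicalClosure _)
  exact subset_trans h1
    (closure_minimal (NonUnitalStarAlgebra.adjoin_le_of_mul_mem S hmul hstar K h) hK)

namespace CircleAction

open CircleRep

variable {A : Type u} [CStarAlgebra A] {α : Circle →* (A ≃⋆ₐ[ℂ] A)}

namespace CovariantRep

variable (ρ : CovariantRep α)

/-- The unitary representation of the circle as a representation by continuous linear maps. -/
def rep : Circle →* (ρ.H →L[ℂ] ρ.H) := (unitary (ρ.H →L[ℂ] ρ.H)).subtype.comp ρ.v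

theorem rep_apply (s : Circle) : ρ.rep s = (ρ.v s : ρ.H →L[ℂ] ρ.H) := rfl

theorem circleRep : CircleRep ρ.rep where
  norm_le s ξ := (ContinuousLinearMap.norm_map_of_mem_unitary (ρ.v s).2 ξ).le
  continuous := ρ.continuous_v

theorem rep_π (s : Circle) (a : A) (ξ : ρ.H) : ρ.rep s (ρ.π a ξ) = ρ.π (α s a) (ρ.rep s ξ) := by
  rw [← ρ.covariant]
  simp only [rep_apply, mul_apply_eq_comp]
  rw [← mul_apply_eq_comp (star _), Unitary.coe_star_mul_self]
  rfl

/-- The projection onto the degree `n` part of a covariant representation. -/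
def proj (n : ℤ) : ρ.H →L[ℂ] ρ.H := ρ.circleRep.coef n

theorem proj_mem (n : ℤ) (ξ : ρ.H) : ρ.proj n ξ ∈ spectral ρ.rep n :=
  ρ.circleRep.coef_mem_spectral n ξ

theorem proj_of_mem {k : ℤ} {ξ : ρ.H} (h : ξ ∈ spectral ρ.rep k) (n : ℤ) :
    ρ.proj n ξ = if k = n then ξ else 0 := ρ.circleRep.coef_of_mem_spectral h n

theorem proj_mul_proj (n k : ℤ) : ρ.proj n * ρ.proj k = if k = n then ρ.proj n else 0 := by
  ext ξ
  rw [mul_apply_eq_comp, ρ.proj_of_mem (ρ.proj_mem k ξ)]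
  split_ifs with h
  · rw [h]
  · rfl

theorem π_mem_spectral {m k : ℤ} {a : A} (ha : a ∈ spectral (toRep α) m) {ξ : ρ.H}
    (h : ξ ∈ spectral ρ.rep k) : ρ.π a ξ ∈ spectral ρ.rep (m + k) := by
  intro s
  rw [rep_π, mem_spectral_toRep.mp ha s, h, map_smul, map_smul, zpow_add₀ (Circle.coe_ne_zero _),
    mul_smul, smul_comm]
  rfl

/-- An element of degree `m` raises the degree of a vector by `m`. -/
theorem proj_mul_π {m : ℤ} {a : A} (ha : a ∈ spectral (toRep α) m) (n : ℤ) :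
    ρ.proj n * ρ.π a = ρ.π a * ρ.proj (n - m) := by
  ext ξ
  simp only [mul_apply_eq_comp]
  have := ρ.circleRep.mem_of_forall_spectral
    ((ρ.proj n * ρ.π a - ρ.π a * ρ.proj (n - m)).ker)
    (ContinuousLinearMap.isClosed_ker _) (fun k η hη => by
      rw [LinearMap.mem_ker]
      simp only [ContinuousLinearMap.coe_coe, sub_apply,
        mul_apply_eq_comp]
      rw [ρ.proj_of_mem hη, ρ.proj_of_mem (ρ.π_mem_spectral ha hη)]
      by_cases h : m + k = n
      · rw [if_pos h, if_pos (by omega), sub_self]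
      · rw [if_neg h, if_neg (by omega), map_zero, sub_self]) ξ
  rw [LinearMap.mem_ker] at this
  exact sub_eq_zero.mp this

theorem star_proj (n : ℤ) : star (ρ.proj n) = ρ.proj n := by
  rw [ContinuousLinearMap.star_eq_adjoint]
  symm
  rw [ContinuousLinearMap.eq_adjoint_iff]
  intro ξ η
  -- The degree `k` part of `y` is zero, yet its integrand pairs with `x` to the constant `⟪x, y⟫`,
  -- by unitarity.
  have orth : ∀ k l, k ≠ l → ∀ x ∈ spectral ρ.rep k, ∀ y ∈ spectral ρ.rep l, inner ℂ x y = 0 := by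
    intro k l hkl x hx y hy
    have h1 : ρ.circleRep.coef k (y) = 0 := by
      rw [ρ.circleRep.coef_of_mem_spectral hy, if_neg hkl.symm]
    rw [coef_apply] at h1
    have h2 : inner ℂ x (∫ t : AddCircle (1 : ℝ), fourier (-k) t • ρ.rep t.toCircle y
        ∂haarAddCircle) = inner ℂ x y := by
      rw [← integral_inner (ρ.circleRep.integrable_integrand _ _)]
      have : ∀ t : AddCircle (1 : ℝ), inner ℂ x (fourier (-k) t • ρ.rep t.toCircle y) =
          inner ℂ x y := fun t => by
        have h3 : inner ℂ (ρ.rep t.toCircle x) (ρ.rep t.toCircle y) = inner ℂ x y :=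
          ContinuousLinearMap.inner_map_map_of_mem_unitary (ρ.v t.toCircle).2 x y
        rw [← h3, hx, inner_smul_left, inner_smul_right, fourier_neg, fourier_eq]
      rw [integral_congr_ae (Filter.Eventually.of_forall this)]
      simp
    rw [← h2, h1, inner_zero_right]
  have key : ∀ k, ∀ x ∈ spectral ρ.rep k, ∀ l, ∀ y ∈ spectral ρ.rep l,
      inner ℂ (ρ.proj n x) y = inner ℂ x (ρ.proj n y) := by
    intro k x hx l y hy
    rw [ρ.proj_of_mem hx, ρ.proj_of_mem hy]
    by_cases h : k = l
    · subst h; split_ifs <;> simp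
    · split_ifs <;> simp [orth k l h x hx y hy]
  have h1 : ∀ k, ∀ x ∈ spectral ρ.rep k, inner ℂ (ρ.proj n x) η = inner ℂ x (ρ.proj n η) := by
    intro k x hx
    have := ρ.circleRep.mem_of_forall_spectral
      ((innerSL ℂ (ρ.proj n x) - (innerSL ℂ x).comp (ρ.proj n)).ker)
      (ContinuousLinearMap.isClosed_ker _) (fun l y hy => by
        simpa [LinearMap.mem_ker, sub_eq_zero] using key k x hx l y hy) η
    simpa [LinearMap.mem_ker, sub_eq_zero] using this
  have h2 := ρ.circleRep.mem_of_forall_spectral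
      ((innerSL ℂ (ρ.proj n η) - (innerSL ℂ η).comp (ρ.proj n)).ker)
      (ContinuousLinearMap.isClosed_ker _) (fun l y hy => by
        have := congrArg (starRingEnd ℂ) (h1 l y hy)
        rw [inner_conj_symm, inner_conj_symm] at this
        simpa [LinearMap.mem_ker, sub_eq_zero] using this.symm) ξ
  have h3 : inner ℂ (ρ.proj n η) ξ = inner ℂ η (ρ.proj n ξ) := by
    simpa [LinearMap.mem_ker, sub_eq_zero] using h2
  have := congrArg (starRingEnd ℂ) h3
  rw [inner_conj_symm, inner_conj_symm] at this
  exact this.symm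

end CovariantRep

/-- The function `ζ ↦ ζ⁻ⁿ a` on the circle. -/
def monomial (n : ℤ) (a : A) : C(Circle, A) where
  toFun ζ := ((ζ ^ (-n) : Circle) : ℂ) • a
  continuous_toFun := by
    have : Continuous fun ζ : Circle => ((ζ ^ (-n) : Circle) : ℂ) :=
      continuous_induced_dom.comp (continuous_zpow _)
    exact this.smul continuous_const

/-- Explains the sign in `monomial`: the projection of degree `n` integrates against `ζ⁻ⁿ`. -/
theorem CovariantRep.integrated_monomial (ρ : CovariantRep α) (n : ℤ) (a : A) :
    ρ.integrated (monomial n a) = ρ.π a * ρ.proj n := by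
  ext ξ
  rw [mul_apply_eq_comp, proj, coef_apply,
    ← ContinuousLinearMap.integral_comp_comm _ (ρ.circleRep.integrable_integrand _ _)]
  change ∫ t : AddCircle (1 : ℝ), _ ∂haarAddCircle = _
  congr 1
  ext t
  simp only [monomial, ContinuousMap.coe_mk, map_smul, fourier_eq, Circle.coe_zpow]
  rfl

/-- Translation on `C(𝕋, A)`. -/
def translation (A : Type u) [CStarAlgebra A] : Circle →* (C(Circle, A) →L[ℂ] C(Circle, A)) where
  toFun s := LinearMap.mkContinuous
    { toFun := fun f => f.comp ⟨fun ζ => ζ * s, by fun_prop⟩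
      map_add' := fun _ _ => rfl
      map_smul' := fun _ _ => rfl } 1 fun f => by
      rw [one_mul]
      exact (ContinuousMap.norm_le _ (norm_nonneg _)).mpr fun ζ => f.norm_coe_le_norm _
  map_one' := by ext f ζ; simp
  map_mul' s t := by ext f ζ; simp [mul_left_comm, mul_comm]

theorem translation_apply (s : Circle) (f : C(Circle, A)) (ζ : Circle) :
    translation A s f ζ = f (ζ * s) := rfl

theorem circleRep_translation : CircleRep (translation A) where
  norm_le s f := (ContinuousMap.norm_le _ (norm_nonneg _)).mpr fun ζ => f.norm_coe_le_norm _
  continuous f := (ContinuousMap.curry ⟨fun p : Circle × Circle => f (p.2 * p.1), by fun_prop⟩).continuous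

/-- Combined with density of homogeneous elements for translation, this makes the monomials span a
dense subspace of `C(𝕋, A)`. -/
theorem eq_monomial_of_mem_spectral {n : ℤ} {f : C(Circle, A)} (hf : f ∈ spectral (translation A) n) :
    f = monomial (-n) (f 1) := by
  ext s
  have := DFunLike.congr_fun (hf s) 1
  rw [translation_apply, one_mul] at this
  rw [this]
  simp [monomial]

theorem CovariantRep.integrated_apply (ρ : CovariantRep α) (f : C(Circle, A)) (ξ : ρ.H) :
    ρ.integrated f ξ = ∫ t : AddCircle (1 : ℝ),
      ρ.π (f t.toCircle) ((ρ.v t.toCircle : ρ.H →L[ℂ] ρ.H) ξ) ∂haarAddCircle := rfl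

instance (α : Circle →* (A ≃⋆ₐ[ℂ] A)) :
    Module ℂ (lp (fun ρ : CovariantRep α => ρ.H →L[ℂ] ρ.H) ∞) :=
  lp.instModuleSubtypePreLpMemAddSubgroup

instance (α : Circle →* (A ≃⋆ₐ[ℂ] A)) :
    SMul ℂ (lp (fun ρ : CovariantRep α => ρ.H →L[ℂ] ρ.H) ∞) :=
  lp.instModuleSubtypePreLpMemAddSubgroup.toDistribMulAction.toDistribSMul.toSMul

/-- The universal integrated form as a continuous linear map. -/
def universalIntegratedL (α : Circle →* (A ≃⋆ₐ[ℂ] A)) :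
    C(Circle, A) →L[ℂ] lp (fun ρ : CovariantRep α => ρ.H →L[ℂ] ρ.H) ∞ :=
  LinearMap.mkContinuous
    { toFun := universalIntegrated α
      map_add' := fun f g => by
        ext1; ext1 ρ; ext1 ξ
        rw [lp.coeFn_add, Pi.add_apply, add_apply]
        change ρ.integrated (f + g) ξ = ρ.integrated f ξ + ρ.integrated g ξ
        rw [ρ.integrated_apply, ρ.integrated_apply, ρ.integrated_apply,
          ← integral_add (ρ.integrable_integrand f ξ) (ρ.integrable_integrand g ξ)]
        simp
      map_smul' := fun c f => by
        ext1; ext1 ρ; ext1 ξ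
        rw [lp.coeFn_smul, Pi.smul_apply, smul_apply]
        change ρ.integrated (c • f) ξ = c • ρ.integrated f ξ
        rw [ρ.integrated_apply, ρ.integrated_apply, ← integral_smul]
        simp }
    1 fun f => by
      rw [one_mul]
      exact lp.norm_le_of_forall_le (norm_nonneg f) fun ρ => ρ.norm_integrated_le f

/-- The universal integrated form of `ζ ↦ ζ⁻ⁿ a`, the product of `a` and the `n`-th spectral
projection. -/
def gen (α : Circle →* (A ≃⋆ₐ[ℂ] A)) (n : ℤ) (a : A) :
    lp (fun ρ : CovariantRep α => ρ.H →L[ℂ] ρ.H) ∞ := universalIntegrated α (monomial n a)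

theorem gen_apply (n : ℤ) (a : A) (ρ : CovariantRep α) : gen α n a ρ = ρ.π a * ρ.proj n :=
  ρ.integrated_monomial n a

theorem gen_add (n : ℤ) (a b : A) : gen α n (a + b) = gen α n a + gen α n b := by
  ext1; ext1 ρ
  rw [lp.coeFn_add, Pi.add_apply]
  simp only [gen_apply, map_add, add_mul]

theorem gen_smul (n : ℤ) (c : ℂ) (a : A) : gen α n (c • a) = c • gen α n a := by
  ext1; ext1 ρ
  rw [lp.coeFn_smul, Pi.smul_apply]
  simp only [gen_apply, map_smul, smul_mul_assoc]

theorem gen_mul_gen (n k m : ℤ) (a b : A) (hb : b ∈ spectral (toRep α) m) :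
    gen α n a * gen α k b = if n = m + k then gen α k (a * b) else 0 := by
  ext1; ext1 ρ
  rw [lp.infty_coeFn_mul, Pi.mul_apply]
  simp only [gen_apply]
  rw [mul_assoc, ← mul_assoc (ρ.proj n), ρ.proj_mul_π hb, mul_assoc, ρ.proj_mul_proj]
  by_cases h : n = m + k
  · rw [if_pos h, if_pos (by omega), gen_apply, map_mul, mul_assoc, h, add_sub_cancel_left]
  · rw [if_neg h, if_neg (by omega), mul_zero, mul_zero]
    rfl

theorem star_gen (n m : ℤ) (a : A) (ha : a ∈ spectral (toRep α) m) :
    star (gen α n a) = gen α (m + n) (star a) := by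
  ext1; ext1 ρ
  rw [lp.coeFn_star, Pi.star_apply]
  simp only [gen_apply]
  rw [star_mul, ρ.star_proj, ← map_star, ρ.proj_mul_π (star_mem_spectral ha), sub_neg_eq_add,
    add_comm]

theorem norm_gen_le (n : ℤ) (a : A) : ‖gen α n a‖ ≤ ‖a‖ := by
  refine ((universalIntegratedL α).le_of_opNorm_le
    (LinearMap.mkContinuous_norm_le _ zero_le_one _) _).trans ?_
  rw [one_mul]
  refine (ContinuousMap.norm_le _ (norm_nonneg _)).mpr fun ζ => ?_
  simp only [monomial, ContinuousMap.coe_mk, norm_smul, Circle.norm_coe, one_mul, le_refl]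

theorem gen_mem (n : ℤ) (a : A) : gen α n a ∈ crossedProduct α :=
  NonUnitalStarSubalgebra.le_topologicalClosure _
    (NonUnitalStarAlgebra.subset_adjoin ℂ _ ⟨_, rfl⟩)

/-- `gen` as a continuous linear map. -/
def genL (α : Circle →* (A ≃⋆ₐ[ℂ] A)) (n : ℤ) :
    A →L[ℂ] lp (fun ρ : CovariantRep α => ρ.H →L[ℂ] ρ.H) ∞ :=
  LinearMap.mkContinuous ⟨⟨gen α n, gen_add n⟩, gen_smul n⟩ 1 fun a => by
    rw [one_mul]; exact norm_gen_le n a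

/-- The homogeneous generators of the crossed product. -/
def homogeneousGens (α : Circle →* (A ≃⋆ₐ[ℂ] A)) :
    Set (lp (fun ρ : CovariantRep α => ρ.H →L[ℂ] ρ.H) ∞) :=
  {x | ∃ n m a, a ∈ spectral (toRep α) m ∧ gen α n a = x}

theorem range_universalIntegrated_subset (hα : IsContinuous α)
    (K : Submodule ℂ (lp (fun ρ : CovariantRep α => ρ.H →L[ℂ] ρ.H) ∞))
    (hK : IsClosed (K : Set (lp (fun ρ : CovariantRep α => ρ.H →L[ℂ] ρ.H) ∞)))
    (h : homogeneousGens α ⊆ K) (f : C(Circle, A)) : universalIntegrated α f ∈ K := by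
  have h1 : ∀ n a, gen α n a ∈ K := fun n a =>
    hα.circleRep.mem_of_forall_spectral (K.comap (genL α n).toLinearMap)
      (hK.preimage (genL α n).continuous) (fun m a ha => show gen α n a ∈ K from h ⟨n, m, a, ha, rfl⟩) a
  exact circleRep_translation.mem_of_forall_spectral
    (K.comap (universalIntegratedL α).toLinearMap) (hK.preimage (universalIntegratedL α).continuous)
    (fun n f hf => by
      rw [eq_monomial_of_mem_spectral hf]
      exact h1 _ _) f

theorem homogeneousGens_mul {x y} (hx : x ∈ homogeneousGens α) (hy : y ∈ homogeneousGens α) :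
    x * y ∈ homogeneousGens α := by
  obtain ⟨n, m, a, ha, rfl⟩ := hx
  obtain ⟨k, l, b, hb, rfl⟩ := hy
  rw [gen_mul_gen n k l a b hb]
  split_ifs
  · exact ⟨k, m + l, a * b, mul_mem_spectral ha hb, rfl⟩
  · exact ⟨0, 0, 0, zero_mem _, (genL α 0).map_zero⟩

theorem star_homogeneousGens_subset : star (homogeneousGens α) ⊆ homogeneousGens α := by
  rintro x ⟨n, m, a, ha, hx⟩
  refine ⟨m + n, -m, star a, star_mem_spectral ha, ?_⟩
  rw [← star_gen n m a ha, hx, star_star]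

theorem mem_of_homogeneousGens_subset (hα : IsContinuous α)
    (K : Submodule ℂ (lp (fun ρ : CovariantRep α => ρ.H →L[ℂ] ρ.H) ∞))
    (hK : IsClosed (K : Set (lp (fun ρ : CovariantRep α => ρ.H →L[ℂ] ρ.H) ∞)))
    (h : homogeneousGens α ⊆ K) {x} (hx : x ∈ crossedProduct α) : x ∈ K := by
  exact NonUnitalStarAlgebra.topologicalClosure_adjoin_subset _ _
    (fun _ hx _ hy => homogeneousGens_mul hx hy) star_homogeneousGens_subset
    (fun K hK h => Set.range_subset_iff.mpr (range_universalIntegrated_subset hα K hK h)) K hK h hx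

end CircleAction

/-! ### Simplicity of the crossed product from its full corner. -/

namespace CircleAction

open CircleRep

variable {A : Type u} [CStarAlgebra A] {α : Circle →* (A ≃⋆ₐ[ℂ] A)}

/-- A C*-algebra densely spanned by products of homogeneous elements of `A` with the spectral
projections of an implementing unitary representation is simple. -/
theorem isSimple_of_generators (hα : IsContinuous α) (hR : RokhlinProperty α)
    (hS : IsSimpleCStarAlgebra (fixedPointAlgebra α))
    {B : Type*} [NonUnitalCStarAlgebra B] (g : ℤ → A →L[ℂ] B)
    (hmul : ∀ n k m a b, b ∈ spectral (toRep α) m →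
      g n a * g k b = if n = m + k then g k (a * b) else 0)
    (hstar : ∀ n m a, a ∈ spectral (toRep α) m → star (g n a) = g (m + n) (star a))
    (hdense : ∀ K : Submodule ℂ B, IsClosed (K : Set B) →
      (∀ n m a, a ∈ spectral (toRep α) m → g n a ∈ K) → ∀ x, x ∈ K)
    (h0 : g 0 1 ≠ 0) : IsSimpleCStarAlgebra B := by
  refine ⟨⟨g 0 1, 0, h0⟩, ?_⟩
  have fixed (a : fixedPointAlgebra α) : (a : A) ∈ spectral (toRep α) 0 :=
    mem_fixedPointAlgebra_iff.mp a.2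
  let φ : fixedPointAlgebra α →⋆ₙₐ[ℂ] B :=
    { toFun := fun a => g 0 a
      map_smul' := fun c a => (g 0).map_smul c (a : A)
      map_zero' := (g 0).map_zero
      map_add' := fun a b => (g 0).map_add a b
      map_mul' := fun a b => by rw [hmul 0 0 0 a b (fixed b), if_pos (add_zero 0).symm]; rfl
      map_star' := fun a => by rw [hstar 0 0 a (fixed a), add_zero]; rfl }
  have hφ (a : fixedPointAlgebra α) : φ a = g 0 a := rfl
  have hφc : Continuous φ := (g 0).continuous.comp continuous_subtype_val
  -- Pulling `I` back to the simple algebra `A^α`: either `p_0 ∈ I`, or `I` meets the image of `φ`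
  -- only in zero.
  have dich : ∀ I : TwoSidedIdeal B, IsClosed (I : Set B) → g 0 1 ∉ I →
      ∀ a : fixedPointAlgebra α, g 0 (a : A) ∈ I → a = 0 := by
    intro I hI h1 a ha
    have hpre : (I.comap φ : Set (fixedPointAlgebra α)) = φ ⁻¹' I :=
      Set.ext fun _ => TwoSidedIdeal.mem_comap φ
    rcases hS.2 (I.comap φ) (hpre ▸ hI.preimage hφc) with h | h
    · have : a ∈ I.comap φ := (TwoSidedIdeal.mem_comap φ).mpr ha
      rwa [h, TwoSidedIdeal.mem_bot] at this
    · refine absurd ?_ h1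
      have : (1 : fixedPointAlgebra α) ∈ I.comap φ := h ▸ trivial
      exact (TwoSidedIdeal.mem_comap φ).mp this
  have hinj : Function.Injective φ := (injective_iff_map_eq_zero φ).mpr fun a ha =>
    dich ⊥ (by
      have : ((⊥ : TwoSidedIdeal B) : Set B) = {0} := by ext; simp
      rw [this]; exact isClosed_singleton) (by rwa [TwoSidedIdeal.mem_bot]) a
      ((TwoSidedIdeal.mem_bot _).mpr ha)
  have hrange : IsClosed (Set.range φ) :=
    (NonUnitalStarAlgHom.isometry φ hinj).isClosedEmbedding.isClosed_range
  -- Fullness of `p_0`: `a p_n = (aw) p_0 (w⁻¹p_n)` with `w ∈ A_n`. Only the existence of `w`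
  -- matters, so the element to commute with is taken to be 0.
  have factor : ∀ n a, ∃ w v, g n a = g 0 w * g 0 1 * g n v := by
    intro n a
    obtain ⟨w, hw, -⟩ := hR.exists_unit_spectral hα 0 n 1 one_pos
    refine ⟨a * w, ((w⁻¹ : Aˣ) : A), ?_⟩
    rw [hmul 0 0 0 _ 1 one_mem_spectral, if_pos (by simp), mul_one,
      hmul 0 n (-n) _ _ (inv_mem_spectral hw), if_pos (by simp), mul_assoc, Units.mul_inv, mul_one]
  -- For `a` of degree `m`, `p_0 (a p_n) p_0` vanishes unless `n = m = 0`. Closedness of the range,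
  -- from injectivity of `φ`, allows passing to limits.
  have corner : ∀ y, g 0 1 * y * g 0 1 ∈ Set.range φ := by
    refine hdense ((LinearMap.range (φ : fixedPointAlgebra α →ₗ[ℂ] B)).comap
      ((LinearMap.mulRight ℂ (g 0 1)).comp (LinearMap.mulLeft ℂ (g 0 1)))) ?_ ?_
    · exact hrange.preimage (f := fun y => g 0 1 * y * g 0 1) (by fun_prop)
    · intro n m a ha
      change g 0 1 * g n a * g 0 1 ∈ Set.range φ
      rw [hmul 0 n m 1 a ha]
      split_ifs with h
      · rw [one_mul, hmul n 0 0 a 1 one_mem_spectral]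
        split_ifs with h'
        · obtain rfl : m = 0 := by omega
          exact ⟨⟨a, mem_fixedPointAlgebra_iff.mpr ha⟩, by rw [mul_one]; rfl⟩
        · exact ⟨0, map_zero φ⟩
      · rw [zero_mul]
        exact ⟨0, map_zero φ⟩
  intro I hI
  by_cases h1 : g 0 1 ∈ I
  · right
    -- `B` need not have a unit, so stability of `I` under scalars is built into `K`.
    let K : Submodule ℂ B :=
      { carrier := {x | ∀ c : ℂ, c • x ∈ I}
        add_mem' := fun ha hb c => by rw [smul_add]; exact I.add_mem (ha c) (hb c)
        zero_mem' := fun c => by rw [smul_zero]; exact I.zero_mem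
        smul_mem' := fun c x hx d => by rw [smul_smul]; exact hx _ }
    have hK : IsClosed (K : Set B) := by
      have : (K : Set B) = ⋂ c : ℂ, {x | c • x ∈ I} := by ext; simp [K]
      rw [this]
      exact isClosed_iInter fun c => hI.preimage (continuous_const_smul c)
    refine top_le_iff.mp fun x _ => ?_
    have := hdense K hK (fun n m a _ c => by
      rw [← map_smul]
      obtain ⟨w, v, h⟩ := factor n (c • a)
      rw [h]
      exact I.mul_mem_right _ _ (I.mul_mem_left _ _ h1)) x 1
    rwa [one_smul] at this
  · left
    refine le_bot_iff.mp fun x hx => (TwoSidedIdeal.mem_bot _).mpr ?_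
    -- These elements lie both in `I` and in the corner; fullness of `p_0` then gives `bxc = 0` for
    -- all `b, c`.
    have hc : ∀ b c, g 0 1 * (b * x * c) * g 0 1 = 0 := by
      intro b c
      obtain ⟨a, ha⟩ := corner (b * x * c)
      rw [← ha]
      rw [dich I hI h1 a, map_zero]
      rw [← hφ, ha]
      exact I.mul_mem_right _ _ (I.mul_mem_left _ _ (I.mul_mem_right _ _ (I.mul_mem_left _ _ hx)))
    have hg : ∀ n a k c, g n a * x * g k c = 0 := by
      intro n a k c
      obtain ⟨w, v, h⟩ := factor n a
      obtain ⟨w', v', h'⟩ := factor k c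
      have := hc (g n v) (g 0 w')
      rw [h, h']
      calc _ = g 0 w * (g 0 1 * (g n v * x * g 0 w') * g 0 1) * g k v' := by
            simp only [mul_assoc]
        _ = 0 := by rw [this, mul_zero, zero_mul]
    have hg2 : ∀ n a c, g n a * x * c = 0 := fun n a =>
      hdense (LinearMap.ker (LinearMap.mulLeft ℂ (g n a * x)))
        (isClosed_singleton.preimage (f := fun c => g n a * x * c) (by fun_prop))
        (fun k _ c _ => hg n a k c)
    have hg3 : ∀ c b, b * x * c = 0 := fun c =>
      hdense (LinearMap.ker ((LinearMap.mulRight ℂ c).comp (LinearMap.mulRight ℂ x)))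
        (isClosed_singleton.preimage (f := fun b => b * x * c) (by fun_prop))
        (fun n _ a _ => hg2 n a c)
    -- This choice yields `(x*x)² = 0`, and the C*-identity applied twice gives `x = 0`.
    have h3 := hg3 (star x * x) (star x)
    have h4 : star (star x * x) * (star x * x) = 0 := by rwa [star_mul, star_star]
    exact (CStarRing.star_mul_self_eq_zero_iff _).mp ((CStarRing.star_mul_self_eq_zero_iff _).mp h4)

theorem isSimple_crossedProduct (hα : IsContinuous α) (hR : RokhlinProperty α)
    (hS : IsSimpleCStarAlgebra (fixedPointAlgebra α)) (h0 : gen α 0 1 ≠ 0) :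
    IsSimpleCStarAlgebra (crossedProduct α) := by
  have hcl : IsClosed (crossedProduct α : Set (lp (fun ρ : CovariantRep α => ρ.H →L[ℂ] ρ.H) ∞)) :=
    NonUnitalStarSubalgebra.isClosed_topologicalClosure _
  let g (n : ℤ) : A →L[ℂ] crossedProduct α :=
    (genL α n).codRestrict (crossedProduct α).toSubmodule (gen_mem n)
  refine isSimple_of_generators hα hR hS g (fun n k m a b hb => ?_) (fun n m a ha => ?_)
    (fun K hK h x => ?_) (fun h => h0 (congrArg Subtype.val h))
  · have := gen_mul_gen n k m a b hb
    apply Subtype.ext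
    split_ifs with h
    · rwa [if_pos h] at this
    · rwa [if_neg h] at this
  · exact Subtype.ext (star_gen n m a ha)
  · have := mem_of_homogeneousGens_subset hα
      (K.map (crossedProduct α).toSubmodule.subtype)
      (hcl.isClosedEmbedding_subtypeVal.isClosedMap _ hK) (by
        rintro _ ⟨n, m, a, ha, rfl⟩
        exact ⟨g n a, h n m a ha, rfl⟩) x.2
    obtain ⟨y, hy, e⟩ := this
    exact (Subtype.ext e : y = x) ▸ hy

end CircleAction

/-! ### Nonvanishing of `p_0`: invariant states and their GNS representations. -/

section

open scoped ComplexOrder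

variable {A : Type u} [CStarAlgebra A]

/-- Compare with `a + it`: the bound `(Im f(a) + t)² ≤ ‖a‖² + t²` for every real `t` is impossible
if `Im f(a) ≠ 0`. -/
theorem im_apply_eq_zero_of_isSelfAdjoint (f : A →L[ℂ] ℂ) (hf : ∀ a, ‖f a‖ ≤ ‖a‖) (h1 : f 1 = 1)
    {a : A} (ha : IsSelfAdjoint a) : (f a).im = 0 := by
  have key : ∀ t : ℝ, ((f a).im + t) ^ 2 ≤ ‖a‖ ^ 2 + t ^ 2 := by
    intro t
    have : Nontrivial A := ⟨1, 0, fun h => one_ne_zero (h1.symm.trans (h ▸ map_zero f))⟩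
    have h2 : ‖a + (t * Complex.I) • (1 : A)‖ ^ 2 ≤ ‖a‖ ^ 2 + t ^ 2 := by
      rw [sq, ← CStarRing.norm_star_mul_self]
      have e : star (a + (t * Complex.I) • (1 : A)) * (a + (t * Complex.I) • (1 : A)) =
          a * a + ((t ^ 2 : ℝ) : ℂ) • (1 : A) := by
        rw [star_add, ha.star_eq, star_smul, star_one]
        simp only [add_mul, mul_add, smul_mul_assoc, mul_smul_comm, one_mul, mul_one]
        have e2 : star ((t : ℂ) * Complex.I) = -(t * Complex.I) := by simp
        have e3 : star ((t : ℂ) * Complex.I) * (t * Complex.I) = ((t ^ 2 : ℝ) : ℂ) := by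
          rw [e2]; push_cast; ring_nf; simp
        rw [smul_add, smul_smul, mul_comm _ (star _), e3, e2, neg_smul]
        abel
      rw [e]
      refine (norm_add_le _ _).trans ?_
      rw [norm_smul, norm_one, mul_one, sq ‖a‖, Complex.norm_real, Real.norm_eq_abs, abs_sq]
      gcongr
      exact norm_mul_le _ _
    have h3 := hf (a + (t * Complex.I) • (1 : A))
    rw [map_add, map_smul, h1, smul_eq_mul, mul_one] at h3
    have h4 := Complex.abs_im_le_norm (f a + t * Complex.I)
    simp only [Complex.add_im, Complex.mul_im, Complex.ofReal_re, Complex.I_im, mul_one,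
      Complex.ofReal_im, Complex.I_re, mul_zero, add_zero] at h4
    calc ((f a).im + t) ^ 2 = |(f a).im + t| ^ 2 := (sq_abs _).symm
      _ ≤ ‖a + (t * Complex.I) • (1 : A)‖ ^ 2 := by gcongr; exact h4.trans h3
      _ ≤ _ := h2
  by_contra hne
  have := key ((‖a‖ ^ 2 + 1) / (2 * (f a).im))
  have e : (f a).im * ((‖a‖ ^ 2 + 1) / (2 * (f a).im)) = (‖a‖ ^ 2 + 1) / 2 := by field_simp
  nlinarith [sq_nonneg (f a).im]

variable [PartialOrder A] [StarOrderedRing A]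

/-- A unital contractive functional on a unital C*-algebra is positive. -/
theorem apply_nonneg_of_contractive (f : A →L[ℂ] ℂ) (hf : ∀ a, ‖f a‖ ≤ ‖a‖) (h1 : f 1 = 1)
    {a : A} (ha : 0 ≤ a) : 0 ≤ f a := by
  have hsa : IsSelfAdjoint a := .of_nonneg ha
  refine Complex.nonneg_iff.mpr ⟨?_, (im_apply_eq_zero_of_isSelfAdjoint f hf h1 hsa).symm⟩
  -- Applying `f` puts `f a` within `‖a‖` of `‖a‖`, hence in the right half-plane.
  have h2 : ‖algebraMap ℝ A ‖a‖ - a‖ ≤ ‖a‖ := by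
    rw [CStarAlgebra.norm_le_iff_le_algebraMap _ (norm_nonneg a)
      (sub_nonneg.mpr hsa.le_algebraMap_norm_self)]
    exact sub_le_self _ ha
  have h3 := (hf _).trans h2
  have h4 : f (algebraMap ℝ A ‖a‖) = ‖a‖ := by
    rw [Algebra.algebraMap_eq_smul_one, ← Complex.coe_smul, map_smul, h1, smul_eq_mul, mul_one]
  rw [map_sub, h4] at h3
  have h5 := (Complex.re_le_norm _).trans h3
  simp at h5
  linarith

end

namespace CircleAction

open CircleRep UniformSpace Completion
open scoped ComplexOrder

variable {A : Type u} [CStarAlgebra A] {α : Circle →* (A ≃⋆ₐ[ℂ] A)}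

/-- Makes every functional that factors through `E` invariant under the action. -/
theorem coef_zero_apply (hα : IsContinuous α) (s : Circle) (a : A) :
    hα.circleRep.coef 0 (α s a) = hα.circleRep.coef 0 a := by
  have := hα.circleRep.mem_of_forall_spectral
    (((hα.circleRep.coef 0).comp (toRep α s) - hα.circleRep.coef 0).ker)
    (ContinuousLinearMap.isClosed_ker _) (fun n x hx => by
      rw [LinearMap.mem_ker]
      change hα.circleRep.coef 0 (toRep α s x) - hα.circleRep.coef 0 x = 0
      rw [hx s, map_smul, hα.circleRep.coef_of_mem_spectral hx]
      split_ifs with h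
      · simp [h]
      · simp) a
  exact sub_eq_zero.mp this

section GNS

variable [PartialOrder A] [StarOrderedRing A] (f : A →ₚ[ℂ] ℂ)

/-- The action of the circle on the pre-Hilbert space of an invariant positive functional. -/
def preGNSRep (hf : ∀ s a, f (α s a) = f a) (s : Circle) : f.PreGNS →L[ℂ] f.PreGNS :=
  LinearMap.mkContinuous (f.toPreGNS.toLinearMap ∘ₗ (α s).toAlgEquiv.toLinearMap ∘ₗ
    f.ofPreGNS.toLinearMap) 1 fun x => by
    rw [one_mul, f.preGNS_norm_def, f.preGNS_norm_def]
    change √(f (star (α s (f.ofPreGNS x)) * α s (f.ofPreGNS x))).re ≤ _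
    rw [← map_star, ← map_mul, hf]

variable {f} (hf : ∀ s a, f (α s a) = f a)

theorem preGNSRep_apply (s : Circle) (x : f.PreGNS) :
    preGNSRep f hf s x = f.toPreGNS (α s (f.ofPreGNS x)) := rfl

theorem inner_preGNSRep (s : Circle) (x y : f.PreGNS) :
    inner ℂ (preGNSRep f hf s x) y = inner ℂ x (preGNSRep f hf s⁻¹ y) := by
  rw [f.preGNS_inner_def, f.preGNS_inner_def, preGNSRep_apply, preGNSRep_apply,
    f.ofPreGNS_toPreGNS, f.ofPreGNS_toPreGNS, ← hf s (star (f.ofPreGNS x) * _), map_mul (α s),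
    map_star, ← StarAlgEquiv.mul_apply (α s), ← map_mul α, mul_inv_cancel, map_one]
  rfl

/-- The unitary representation of the circle on the Hilbert space of an invariant positive
functional. -/
def gnsRep (s : Circle) : f.GNS →L[ℂ] f.GNS := (preGNSRep f hf s).completion

theorem gnsRep_coe (s : Circle) (x : f.PreGNS) : gnsRep hf s x = (preGNSRep f hf s x : f.PreGNS) :=
  ContinuousLinearMap.completion_apply_coe _ _

theorem gnsRep_mul (s t : Circle) : gnsRep hf (s * t) = gnsRep hf s * gnsRep hf t := by
  ext ξ
  induction ξ using induction_on with
  | hp => apply isClosed_eq <;> fun_prop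
  | ih x =>
    rw [mul_apply_eq_comp, gnsRep_coe, gnsRep_coe, gnsRep_coe]
    simp [preGNSRep_apply]

theorem gnsRep_one : gnsRep hf 1 = 1 := by
  ext ξ
  induction ξ using induction_on with
  | hp => apply isClosed_eq <;> fun_prop
  | ih x =>
    rw [gnsRep_coe]
    simp [preGNSRep_apply]

theorem star_gnsRep (s : Circle) : star (gnsRep hf s) = gnsRep hf s⁻¹ := by
  symm
  refine (ContinuousLinearMap.eq_adjoint_iff _ _).mpr fun ξ η => ?_
  induction ξ, η using induction_on₂ with
  | hp => apply isClosed_eq <;> fun_prop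
  | ih x y =>
    rw [gnsRep_coe, gnsRep_coe, inner_coe, inner_coe, inner_preGNSRep, inv_inv]

theorem gnsRep_mem_unitary (s : Circle) : gnsRep hf s ∈ unitary (f.GNS →L[ℂ] f.GNS) := by
  rw [Unitary.mem_iff, star_gnsRep, ← gnsRep_mul, ← gnsRep_mul, inv_mul_cancel, mul_inv_cancel,
    gnsRep_one]
  exact ⟨rfl, rfl⟩

/-- Orbits of vectors from `A` are continuous, and orbits of nearby vectors are uniformly close
because each operator is unitary. -/
theorem continuous_gnsRep (hα : IsContinuous α) (hfn : ∀ a, ‖f a‖ ≤ ‖a‖) (ξ : f.GNS) :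
    Continuous fun s => gnsRep hf s ξ := by
  have hn : ∀ a : A, ‖f.toPreGNS a‖ ≤ ‖a‖ := fun a => by
    rw [f.preGNS_norm_def, f.ofPreGNS_toPreGNS]
    refine Real.sqrt_le_iff.mpr ⟨norm_nonneg _, (Complex.re_le_norm _).trans ((hfn _).trans ?_)⟩
    rw [CStarRing.norm_star_mul_self, sq]
  have hc : Continuous f.toPreGNS :=
    AddMonoidHomClass.continuous_of_bound f.toPreGNS 1 fun a => by rw [one_mul]; exact hn a
  refine continuous_of_uniform_approx_of_continuous fun u hu => ?_
  obtain ⟨ε, hε, hεu⟩ := Metric.mem_uniformity_dist.mp hu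
  obtain ⟨_, ⟨x, rfl⟩, hx⟩ := Metric.mem_closure_iff.mp
    ((denseRange_coe (α := f.PreGNS)) ξ) ε hε
  refine ⟨fun s => gnsRep hf s x, ?_, fun s => hεu ?_⟩
  · simp only [gnsRep_coe, preGNSRep_apply]
    exact (continuous_coe _).comp (hc.comp (hα _))
  · rw [dist_eq_norm, ← map_sub,
      ContinuousLinearMap.norm_map_of_mem_unitary (gnsRep_mem_unitary hf s), ← dist_eq_norm]
    exact hx

theorem gnsRep_covariant (s : Circle) (a : A) :
    gnsRep hf s * f.gnsStarAlgHom a * star (gnsRep hf s) = f.gnsStarAlgHom (α s a) := by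
  rw [star_gnsRep]
  ext ξ
  induction ξ using induction_on with
  | hp => apply isClosed_eq <;> fun_prop
  | ih x =>
    have h (b : A) (y : f.PreGNS) : f.gnsStarAlgHom b (y : f.GNS) = f.toPreGNS (b * f.ofPreGNS y) :=
      f.gnsNonUnitalStarAlgHom_apply_coe
    rw [mul_apply_eq_comp, mul_apply_eq_comp, gnsRep_coe, h, h, gnsRep_coe, preGNSRep_apply,
      preGNSRep_apply, f.ofPreGNS_toPreGNS, f.ofPreGNS_toPreGNS, map_mul (α s),
      ← StarAlgEquiv.mul_apply (α s), ← map_mul α, mul_inv_cancel, map_one]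
    rfl

/-- The covariant representation associated with an invariant contractive positive functional. -/
def gnsCovariantRep (hα : IsContinuous α) (hfn : ∀ a, ‖f a‖ ≤ ‖a‖) : CovariantRep α where
  H := f.GNS
  π := f.gnsStarAlgHom
  v :=
    { toFun := fun s => ⟨gnsRep hf s, gnsRep_mem_unitary hf s⟩
      map_one' := Subtype.ext (gnsRep_one hf)
      map_mul' := fun s t => Subtype.ext (gnsRep_mul hf s t) }
  continuous_v := continuous_gnsRep hf hα hfn
  covariant := gnsRep_covariant hf

end GNS

/-- For an invariant state, the GNS class of 1 is a nonzero vector fixed by the circle, so `p_0`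
fixes it. -/
theorem gen_zero_one_ne_zero [Nontrivial A] (hα : IsContinuous α) : gen α 0 1 ≠ 0 := by
  let _ := CStarAlgebra.spectralOrder A
  have := CStarAlgebra.spectralOrderedRing A
  obtain ⟨p, hp, hp1⟩ := exists_dual_vector ℂ (1 : A) (by simp)
  set q : A →L[ℂ] ℂ := p.comp (hα.circleRep.coef 0) with hq
  have hqn : ∀ a, ‖q a‖ ≤ ‖a‖ := fun a => by
    refine (p.le_opNorm _).trans ?_
    rw [hp, one_mul]
    exact hα.circleRep.norm_coef_le 0 a
  have hq1 : q 1 = 1 := by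
    rw [hq, ContinuousLinearMap.comp_apply, hα.circleRep.coef_of_mem_spectral one_mem_spectral,
      if_pos rfl, hp1]
    simp
  let f : A →ₚ[ℂ] ℂ := PositiveLinearMap.mk₀ q.toLinearMap
    fun a ha => apply_nonneg_of_contractive q hqn hq1 ha
  have hf : ∀ s a, f (α s a) = f a := fun s a => congrArg p (coef_zero_apply hα s a)
  let ρ := gnsCovariantRep hf hα hqn
  intro h
  have h1 : gen α 0 1 ρ = 0 := by rw [h]; rfl
  rw [gen_apply, map_one, one_mul] at h1
  let x : f.PreGNS := f.toPreGNS 1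
  let ξ : ρ.H := (x : f.GNS)
  have hx : ξ ∈ spectral ρ.rep 0 := fun s => by
    rw [zpow_zero, one_smul]
    refine (gnsRep_coe hf s x).trans ?_
    rw [preGNSRep_apply, f.ofPreGNS_toPreGNS, map_one]
  have h2 := ρ.proj_of_mem hx 0
  rw [h1, if_pos rfl] at h2
  have h3 : ‖x‖ = 0 := by
    rw [← norm_coe x]
    exact (congrArg norm h2.symm).trans norm_zero
  rw [f.preGNS_norm_def] at h3
  have h4 : f 1 = 1 := hq1
  simp [x, h4] at h3

end CircleAction

end

theorem mainTheorem11 {A : Type*} [CStarAlgebra A] (hA : IsSimpleCStarAlgebra A)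
    (α : Circle →* (A ≃⋆ₐ[ℂ] A)) (hα : CircleAction.IsContinuous α)
    (hR : CircleAction.RokhlinProperty α) :
    IsSimpleCStarAlgebra (CircleAction.fixedPointAlgebra α) ∧
      IsSimpleCStarAlgebra (CircleAction.crossedProduct α) := by
  have : Nontrivial A := hA.1
  have h := CircleAction.isSimple_fixedPointAlgebra hA hα hR
  exact ⟨h, CircleAction.isSimple_crossedProduct hα hR h (CircleAction.gen_zero_one_ne_zero hα)⟩
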